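/- Let $\Gamma$ be a group with a finite generating set $S$ such that $S=S^{-1}$ and $1\notin S$, and suppose that its Cayley graph $G$ is hyperbolic: with $d$ the graph metric and $(x\,|\,y)_w=\tfrac12\bigl(d(x,w)+d(y,w)-d(x,y)\bigr)$, there is $\delta\ge 0$ with $(x\,|\,y)_w\ge\min\{(x\,|\,z)_w,(y\,|\,z)_w\}-\delta$ for all $x,y,z,w\in\Gamma$. Write $|x|=d(1,x)$. Let $\partial G$ be the set of geodesic rays starting from $1$ modulo bounded distance, with the quasi-metric $\rho(\xi,\xi')=e^{-(\xi|\xi')}$, where $(\xi\,|\,\xi')=\sup\{\liminf_{n,m\to\infty}(\gamma(n)\,|\,\gamma'(m))_1:\gamma\in\xi,\ \gamma'\in\xi'\}$; let $B(\xi,r)$ be the $\rho$-ball, and give $\partial G$ the Borel $\sigma$-algebra of the topology induced by $\rho$. Let $X$ be a Markov chain on $\Gamma$ started from $1$ whose transition kernel is nearest neighbour (it moves only along edges of $G$), let $p^n$ be its $n$-step transition probabilities and $\mathbb P$ its distribution on $\Gamma^{\mathbb Z_+}$. Suppose that $X$ is regular with entropy $h\ge 0$ and speed $l$, that is, for $\mathbb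 P$-almost every path $x=(x_n)$, $$\lim_{n\to\infty}\frac{-\log p^n(1,x_n)}{n}=h,\qquad \lim_{n\to\infty}\frac{|x_n|}{n}=l ,$$ and suppose that $l>0$. Then the harmonic measure $\nu$ of $X$ on $\partial G$ is well defined: there is exactly one measure $\nu$ that is the image of $\mathbb P$ under an almost everywhere defined measurable map sending $\mathbb P$-almost every path $x$ to the class $\xi_x$ of a geodesic ray $\gamma$ from $1$ with $\lim_{n\to\infty}\frac1n d(x_n,\gamma(\lfloor ln\rfloor))=0$. Moreover, for $\nu$-almost every $\xi$, $$\limsup_{r\to 0}\frac{\log\nu(B(\xi,r))}{\log r}\le\frac hl .$$ In particular $\dim\nu\le h/l$, where $\dim\nu=\inf\{\dim_\rho E: E\subset\partial G\text{ Borel},\ \nu(E)=1\}$ and $\dim_\rho$ denotes the Hausdorff dimension with respect to $\rho$. -/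

import Mathlib

open MeasureTheory ProbabilityTheory Filter Topology
open scoped ENNReal NNReal

/-! Random walks on hyperbolic Cayley graphs, Gromov boundaries and harmonic measures. -/

namespace HypWalk

noncomputable section

section Geometry

variable {Γ : Type*} [Group Γ]

/-- The graph metric of the Cayley graph of `Γ` with respect to `S` (vertices `g`, `h` are adjacent
iff `g ≠ h` and `h = g * s` or `g = h * s` for some `s ∈ S`). -/
def wdist (S : Set Γ) (g h : Γ) : ℕ := (SimpleGraph.mulCayley S).dist g h

/-- The Gromov product `(x | y)_z` in the Cayley graph. -/
def gromovProd (S : Set Γ) (x y z : Γ) : ℝ :=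
  ((wdist S x z : ℝ) + wdist S y z - wdist S x y) / 2

/-- The Cayley graph is `δ`-hyperbolic for some `δ ≥ 0`. -/
def IsHyperbolic (S : Set Γ) : Prop :=
  ∃ δ : ℝ, 0 ≤ δ ∧ ∀ x y z w : Γ,
    min (gromovProd S x z w) (gromovProd S y z w) - δ ≤ gromovProd S x y w

/-- Unit speed geodesic rays (of vertices) starting from `1`. -/
structure Ray (S : Set Γ) where
  /-- the position of the ray at time `n` -/
  pos : ℕ → Γ
  start : pos 0 = 1
  geodesic : ∀ m n : ℕ, m ≤ n → wdist S (pos m) (pos n) = n - m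

/-- Two rays are equivalent when they are within a bounded distance. (The extended graph distance
is used; for a generating set it is the graph distance.) -/
instance raySetoid (S : Set Γ) : Setoid (Ray S) where
  r γ γ' := ∃ C : ℕ, ∀ n : ℕ, (SimpleGraph.mulCayley S).edist (γ.pos n) (γ'.pos n) ≤ C
  iseqv :=
    { refl := fun γ => ⟨0, fun n => by simp⟩
      symm := fun ⟨C, hC⟩ => ⟨C, fun n => by rw [SimpleGraph.edist_comm]; exact hC n⟩
      trans := fun ⟨C, hC⟩ ⟨D, hD⟩ => ⟨C + D, fun n => by
        push_cast
        exact (SimpleGraph.edist_triangle).trans (add_le_add (hC n) (hD n))⟩ }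

/-- The Gromov boundary of the Cayley graph. -/
def Boundary (S : Set Γ) : Type _ := Quotient (raySetoid S)

/-- The boundary point represented by a ray. -/
def Ray.endpoint {S : Set Γ} (γ : Ray S) : Boundary S := Quotient.mk (raySetoid S) γ

/-- The Gromov product of two boundary points, with base point `1`: the supremum over all
representing rays of `liminf_{n, m → ∞} (γ n | γ' m)_1`, an element of `[0, ∞]`. -/
def bdryProd {S : Set Γ} (ξ ξ' : Boundary S) : EReal :=
  ⨆ (γ : Ray S) (γ' : Ray S) (_ : γ.endpoint = ξ) (_ : γ'.endpoint = ξ'),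
    liminf (fun p : ℕ × ℕ => ((gromovProd S (γ.pos p.1) (γ'.pos p.2) 1 : ℝ) : EReal)) atTop

/-- The quasi-metric `ρ(ξ, ξ') = exp (-(ξ | ξ'))`, where `exp (-∞) = 0`. -/
def rho {S : Set Γ} (ξ ξ' : Boundary S) : ℝ≥0∞ := EReal.exp (-bdryProd ξ ξ')

/-- The ball `B(ξ, r)` for the quasi-metric. -/
def bdryBall {S : Set Γ} (ξ : Boundary S) (r : ℝ) : Set (Boundary S) :=
  {η | rho ξ η < ENNReal.ofReal r}

/-- The topology of the quasi-metric: a set is open iff it contains a ball around each of its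
points. -/
instance (S : Set Γ) : TopologicalSpace (Boundary S) where
  IsOpen U := ∀ ξ ∈ U, ∃ r : ℝ, 0 < r ∧ bdryBall ξ r ⊆ U
  isOpen_univ := fun _ _ => ⟨1, one_pos, Set.subset_univ _⟩
  isOpen_inter := fun U V hU hV ξ hξ => by
    obtain ⟨r, hr, hrU⟩ := hU ξ hξ.1
    obtain ⟨s, hs, hsV⟩ := hV ξ hξ.2
    refine ⟨min r s, lt_min hr hs, fun η hη => ⟨hrU ?_, hsV ?_⟩⟩
    · exact lt_of_lt_of_le hη (ENNReal.ofReal_le_ofReal (min_le_left _ _))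
    · exact lt_of_lt_of_le hη (ENNReal.ofReal_le_ofReal (min_le_right _ _))
  isOpen_sUnion := fun 𝒰 h𝒰 ξ ⟨U, hU, hξ⟩ => by
    obtain ⟨r, hr, hrU⟩ := h𝒰 U hU ξ hξ
    exact ⟨r, hr, hrU.trans (Set.subset_sUnion_of_mem hU)⟩

/-- The boundary carries its Borel σ-algebra. -/
instance (S : Set Γ) : MeasurableSpace (Boundary S) := borel _

instance (S : Set Γ) : BorelSpace (Boundary S) := ⟨rfl⟩

/-- The path `x` tracks, at linear speed `l` and up to a sublinear error, a unit speed geodesic ray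
representing `ξ`. -/
def Tracks (S : Set Γ) (l : ℝ) (x : ℕ → Γ) (ξ : Boundary S) : Prop :=
  ∃ γ : Ray S, γ.endpoint = ξ ∧
    Tendsto (fun n : ℕ => (wdist S (x n) (γ.pos ⌊l * n⌋₊) : ℝ) / n) atTop (𝓝 0)

end Geometry

section Dimension

variable {X : Type*}

/-- The diameter of a set with respect to a quasi-metric `ρ`. -/
def qdiam (ρ : X → X → ℝ≥0∞) (A : Set X) : ℝ≥0∞ := ⨆ (x ∈ A) (y ∈ A), ρ x y

/-- The `d`-dimensional Hausdorff (outer) measure of `E` with respect to a quasi-metric `ρ`. -/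
def qHausdorff (ρ : X → X → ℝ≥0∞) (d : ℝ≥0) (E : Set X) : ℝ≥0∞ :=
  ⨆ (r : ℝ≥0∞) (_ : 0 < r),
    ⨅ (t : ℕ → Set X) (_ : E ⊆ ⋃ n, t n) (_ : ∀ n, qdiam ρ (t n) ≤ r),
      ∑' n, ⨆ _ : (t n).Nonempty, qdiam ρ (t n) ^ (d : ℝ)

/-- The Hausdorff dimension of `E` with respect to a quasi-metric `ρ`. -/
def qdim (ρ : X → X → ℝ≥0∞) (E : Set X) : ℝ≥0∞ :=
  ⨆ (d : ℝ≥0) (_ : qHausdorff ρ d E = ∞), (d : ℝ≥0∞)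

/-- The (upper) Hausdorff dimension of a Borel probability measure: the infimum of the Hausdorff
dimensions of the Borel sets of full measure. -/
def measureDim [MeasurableSpace X] (ρ : X → X → ℝ≥0∞) (ν : Measure X) : ℝ≥0∞ :=
  ⨅ (E : Set X) (_ : MeasurableSet E) (_ : ν E = 1), qdim ρ E

end Dimension

section Walk

variable {Γ : Type*}

/-- The `n`-step transition probabilities of a Markov kernel on a discrete space. -/
def nStep (P : Γ → PMF Γ) : ℕ → Γ → PMF Γ
  | 0, g => PMF.pure g
  | n + 1, g => (nStep P n g).bind P

variable [Group Γ]

/-- The kernel only allows steps along edges of the Cayley graph. -/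
def IsNearestNeighbor (S : Set Γ) (P : Γ → PMF Γ) : Prop :=
  ∀ g g' : Γ, P g g' ≠ 0 → (SimpleGraph.mulCayley S).Adj g g'

variable [MeasurableSpace Γ] [DiscreteMeasurableSpace Γ]

/-- Given the path up to time `n`, the next position is distributed according to `P (x n)`. -/
def stepKernel (P : Γ → PMF Γ) (n : ℕ) : Kernel (Finset.Iic n → Γ) Γ where
  toFun x := (P (x ⟨n, Finset.mem_Iic.2 le_rfl⟩)).toMeasure
  measurable' :=
    (Measurable.of_discrete (f := fun g : Γ => (P g).toMeasure)).comp
      (measurable_pi_apply (⟨n, Finset.mem_Iic.2 le_rfl⟩ : Finset.Iic n))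

instance (P : Γ → PMF Γ) (n : ℕ) : IsMarkovKernel (stepKernel P n) where
  isProbabilityMeasure x := by
    change IsProbabilityMeasure (P (x ⟨n, Finset.mem_Iic.2 le_rfl⟩)).toMeasure
    infer_instance

/-- The distribution on the path space of the Markov chain with kernel `P` started from `1`. -/
def pathMeasure (P : Γ → PMF Γ) : Measure (ℕ → Γ) :=
  Kernel.trajMeasure (X := fun _ : ℕ => Γ) (Measure.dirac (1 : Γ)) (stepKernel P)

instance (P : Γ → PMF Γ) : IsProbabilityMeasure (pathMeasure P) := by
  unfold pathMeasure; infer_instance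

/-- The finite-dimensional distributions of `pathMeasure P`. -/
theorem pathMeasure_cylinder [DecidableEq Γ] (P : Γ → PMF Γ) (w : ℕ → Γ) (n : ℕ) :
    pathMeasure P {x | ∀ i ≤ n, x i = w i} =
      (if w 0 = 1 then 1 else 0) * ∏ i ∈ Finset.range n, P (w i) (w (i + 1)) := by
  have key : ∀ n : ℕ, (pathMeasure P).map (Preorder.frestrictLe n)
      {fun i : Finset.Iic n => w i} = pathMeasure P {x | ∀ i ≤ n, x i = w i} := fun n => by
    rw [Measure.map_apply (by fun_prop) (measurableSet_singleton _)]
    congr 1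
    ext x
    simp [funext_iff, Preorder.frestrictLe]
  induction n with
  | zero =>
    rw [← key, pathMeasure, Kernel.trajMeasure, Measure.map_comp _ _ (by fun_prop),
      Kernel.traj_map_frestrictLe, Kernel.partialTraj_self, Measure.id_comp,
      Measure.map_apply (by fun_prop) (measurableSet_singleton _),
      Measure.dirac_apply' _ (MeasurableSet.of_discrete)]
    have hiff : (1 : Γ) ∈ (MeasurableEquiv.piUnique fun _ : Finset.Iic 0 => Γ).symm ⁻¹'
        {fun i : Finset.Iic 0 => w i} ↔ w 0 = 1 := by
      simp only [Set.mem_preimage, Set.mem_singleton_iff, funext_iff]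
      constructor
      · intro H
        exact (H ⟨0, by simp⟩).symm
      · rintro H ⟨i, hi⟩
        obtain rfl : i = 0 := by simpa using hi
        exact H.symm
    by_cases h0 : w 0 = 1
    · rw [Set.indicator_of_mem (hiff.2 h0)]
      simp [h0]
    · rw [Set.indicator_of_notMem (fun hm => h0 (hiff.1 hm))]
      simp [h0]
  | succ n ih =>
    have hset : {x : ℕ → Γ | ∀ i ≤ n + 1, x i = w i} =
        (fun x : ℕ → Γ => (Preorder.frestrictLe (π := fun _ : ℕ => Γ) n x, x (n + 1))) ⁻¹'
          ({fun i : Finset.Iic n => w i} ×ˢ {w (n + 1)}) := by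
      ext x
      simp only [Set.mem_ofPred_eq, Set.mem_preimage, Set.mem_prod, Set.mem_singleton_iff,
        funext_iff, Preorder.frestrictLe, Finset.restrict, Subtype.forall, Finset.mem_Iic]
      constructor
      · exact fun H => ⟨fun i hi => H i (by omega), H _ le_rfl⟩
      · rintro ⟨H, H'⟩ i hi
        rcases Nat.lt_or_ge n i with h | h
        · obtain rfl : i = n + 1 := by omega
          exact H'
        · exact H i h
    have hm : MeasurableSet ({fun i : Finset.Iic n => w i} : Set (Finset.Iic n → Γ)) :=
      measurableSet_singleton _
    rw [hset, ← Measure.map_apply (by fun_prop) (hm.prod (measurableSet_singleton _))]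
    have := Kernel.map_frestrictLe_trajMeasure_compProd_eq_map_trajMeasure
      (X := fun _ : ℕ => Γ) (μ₀ := Measure.dirac (1 : Γ)) (κ := stepKernel P) (a := n)
    rw [pathMeasure, ← this, Measure.compProd_apply_prod hm (measurableSet_singleton _),
      lintegral_singleton, ← pathMeasure, key, ih, Finset.prod_range_succ]
    have : stepKernel P n (fun i : Finset.Iic n => w i) {w (n + 1)} = P (w n) (w (n + 1)) :=
      PMF.toMeasure_apply_singleton _ _ (measurableSet_singleton _)
    rw [this]
    ring

/-- The chain with kernel `P` started from `1` is regular, with entropy `h` and speed `l`. -/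
structure IsRegularChain (S : Set Γ) (P : Γ → PMF Γ) (h l : ℝ) : Prop where
  entropy_nonneg : 0 ≤ h
  speed_nonneg : 0 ≤ l
  entropy : ∀ᵐ x ∂pathMeasure P,
    Tendsto (fun n : ℕ => -Real.log (nStep P n 1 (x n)).toReal / n) atTop (𝓝 h)
  speed : ∀ᵐ x ∂pathMeasure P,
    Tendsto (fun n : ℕ => (wdist S 1 (x n) : ℝ) / n) atTop (𝓝 l)

/-- `ν` is the harmonic measure of the chain with kernel `P` and speed `l`: the image of the path
measure under the boundary map, which sends almost every path to the endpoint of the geodesic ray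
that it tracks. -/
def IsHarmonicMeasure (S : Set Γ) (P : Γ → PMF Γ) (l : ℝ) (ν : Measure (Boundary S)) : Prop :=
  ∃ bnd : (ℕ → Γ) → Boundary S, AEMeasurable bnd (pathMeasure P) ∧
    (∀ᵐ x ∂pathMeasure P, Tracks S l x (bnd x)) ∧ ν = (pathMeasure P).map bnd

end Walk

end

end HypWalk

open HypWalk

namespace HypWalk

/-! ### Cayley graph geometry: segments, finite balls, hyperbolicity at the base point -/

section Graph

variable {Γ : Type*} [Group Γ] {S : Set Γ}

/-! Let `a < l`. Neighbours `x n`, `x (n+1)` of a typical path have Gromov product about `l * n`.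
Passing from `n` to `2 * n` by bisection costs only `δ` times a logarithm, so `(x n | x m) ≥ a * n`
for all `m ≥ n` once `n` is large (`IsLinearPath.eventually_le_gromovProd`). Segments from `1` to `x
n` have limit rays by local finiteness; the path tracks each of them, and the tracked point is
unique. This gives the boundary map, whose measurability follows because limits can be detected on
initial pieces of segments.

For the dimension, fix a set of paths converging at rate `a` from time `M` on. Those among them that
visit `g` at time `n` have limits at mutual distance at most a constant times `exp (-a * n)`, so
they end in a small shadow of `g`. By Borel–Cantelli, conditioning on `x n` costs at most a
subexponential factor (`ae_eventually_mul_nStep_le`), and the entropy gives `p^n(1, x n) ≥ exp (-b'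
* n)` for `b' > h`. Hence the shadow of `x n` has mass at least `exp (-b * n)` for every `b > h`
(`exists_covers`). A ball around the limit contains that shadow, which bounds the local dimension by
`b / a`. The events `x n = g` are disjoint, so at most `exp (b * n)` shadows are heavy; covering by
these bounds the Hausdorff dimension directly. Finally `a → l` and `b → h`. -/

theorem mulCayley_connected (hgen : Subgroup.closure S = ⊤) :
    (SimpleGraph.mulCayley S).Connected := by
  have key : ∀ g : Γ, ∀ x : Γ, (SimpleGraph.mulCayley S).Reachable x (x * g) := by
    intro g
    have hg : g ∈ Subgroup.closure S := by rw [hgen]; trivial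
    induction hg using Subgroup.closure_induction with
    | mem s hs =>
      intro x
      by_cases h : x = x * s
      · rw [← h]
      · exact SimpleGraph.Adj.reachable
          ((SimpleGraph.mulCayley_adj' S _ _).2 ⟨h, s, hs, Or.inl rfl⟩)
    | one => intro x; rw [mul_one]
    | mul g g' _ _ h h' => intro x; rw [← mul_assoc]; exact (h x).trans (h' _)
    | inv g _ h =>
      intro x
      have := h (x * g⁻¹)
      rw [inv_mul_cancel_right] at this
      exact this.symm
  have : Nonempty Γ := ⟨1⟩
  exact ⟨fun x y => by simpa using key (x⁻¹ * y) x⟩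

theorem wdist_comm (x y : Γ) : wdist S x y = wdist S y x := SimpleGraph.dist_comm

theorem wdist_self (x : Γ) : wdist S x x = 0 := SimpleGraph.dist_self

theorem wdist_triangle (hc : (SimpleGraph.mulCayley S).Connected) (x y z : Γ) :
    wdist S x z ≤ wdist S x y + wdist S y z := hc.dist_triangle

theorem wdist_of_adj {x y : Γ} (h : (SimpleGraph.mulCayley S).Adj x y) : wdist S x y = 1 :=
  SimpleGraph.dist_eq_one_iff_adj.2 h

/-- Existence of geodesic segments issued from `1`. -/
theorem exists_geodesic (hc : (SimpleGraph.mulCayley S).Connected) (g : Γ) :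
    ∃ c : ℕ → Γ, c 0 = 1 ∧ c (wdist S g 1) = g ∧
      (∀ i j, i ≤ j → j ≤ wdist S g 1 → wdist S (c i) (c j) = j - i) ∧
      ∀ i, wdist S (c i) 1 ≤ i := by
  obtain ⟨p, hp⟩ := hc.exists_walk_length_eq_dist 1 g
  have hp' : p.length = wdist S g 1 := by rw [wdist_comm]; exact hp
  have hlip : ∀ i k, wdist S (p.getVert i) (p.getVert (i + k)) ≤ k := by
    intro i k
    induction k with
    | zero => simp [wdist_self]
    | succ k ih =>
      refine (wdist_triangle hc _ (p.getVert (i + k)) _).trans (add_le_add ih ?_)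
      rcases lt_or_ge (i + k) p.length with h | h
      · exact (wdist_of_adj (p.adj_getVert_succ h)).le
      -- Past its length the walk stays at its endpoint, so the Lipschitz bound, and with it the
      -- last clause, holds for every index.
      · rw [← add_assoc, p.getVert_of_length_le h, p.getVert_of_length_le (by omega), wdist_self]
        exact Nat.zero_le _
  have h0 : p.getVert 0 = 1 := p.getVert_zero
  have h1 : p.getVert (wdist S g 1) = g := by rw [← hp']; exact p.getVert_length
  refine ⟨p.getVert, h0, h1, fun i j hij hj => le_antisymm ?_ ?_, fun i => ?_⟩
  · have := hlip i (j - i)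
    rwa [Nat.add_sub_cancel' hij] at this
  · have a1 := hlip 0 i
    have a2 := hlip j (wdist S g 1 - j)
    rw [Nat.add_sub_cancel' hj, h1] at a2
    rw [h0, zero_add] at a1
    have a3 := wdist_triangle hc 1 (p.getVert i) g
    have a4 := wdist_triangle hc (p.getVert i) (p.getVert j) g
    rw [wdist_comm 1 g] at a3
    omega
  · have := hlip 0 i
    rwa [h0, zero_add, wdist_comm] at this

theorem finite_ball (hfin : S.Finite) (hc : (SimpleGraph.mulCayley S).Connected) (r : ℕ) :
    {g : Γ | wdist S g 1 ≤ r}.Finite := by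
  induction r with
  | zero =>
    refine (Set.finite_singleton (1 : Γ)).subset fun g hg => ?_
    exact hc.dist_eq_zero_iff.1 (Nat.le_zero.1 hg)
  | succ r ih =>
    refine (ih.union ((ih.mul hfin).union (ih.mul hfin.inv))).subset fun g hg => ?_
    rcases Nat.lt_or_ge r (wdist S g 1) with h | h
    swap
    · exact Or.inl h
    have hr : wdist S g 1 = r + 1 := le_antisymm hg h
    obtain ⟨c, -, h1, h2, h3⟩ := exists_geodesic hc g
    have hd : wdist S (c r) g = 1 := by
      have := h2 r (r + 1) (by omega) (by omega)
      rw [← hr, h1] at this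
      omega
    obtain ⟨-, s, hs, hh⟩ :=
      (SimpleGraph.mulCayley_adj' S _ _).1 (SimpleGraph.dist_eq_one_iff_adj.1 hd)
    right
    rcases hh with hh | hh
    · exact Or.inl ⟨c r, h3 r, s, hs, hh⟩
    · exact Or.inr ⟨c r, h3 r, s⁻¹, Set.inv_mem_inv.2 hs, by simp [hh]⟩

theorem countable_of_connected (hfin : S.Finite) (hc : (SimpleGraph.mulCayley S).Connected) :
    Countable Γ := by
  have : (Set.univ : Set Γ) = ⋃ r : ℕ, {g : Γ | wdist S g 1 ≤ r} := by
    ext g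
    simpa using ⟨wdist S g 1, le_rfl⟩
  exact Set.countable_univ_iff.1
    (this ▸ Set.countable_iUnion fun r => (finite_ball hfin hc r).countable)

/-- `δ` is a hyperbolicity constant for the Gromov product based at `1`. -/
def IsHypConst (S : Set Γ) (δ : ℝ) : Prop :=
  0 ≤ δ ∧ ∀ x y z : Γ, min (gromovProd S x z 1) (gromovProd S z y 1) - δ ≤ gromovProd S x y 1

theorem gromovProd_comm (x y w : Γ) : gromovProd S x y w = gromovProd S y x w := by
  simp only [gromovProd, wdist_comm x y]; ring

theorem IsHyperbolic.exists_isHypConst (h : IsHyperbolic S) : ∃ δ, IsHypConst S δ := by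
  obtain ⟨δ, h0, h⟩ := h
  refine ⟨δ, h0, fun x y z => ?_⟩
  rw [gromovProd_comm z y]
  exact h x y z 1

/-- The form in which hyperbolicity is used below: each intermediate point costs one `δ`. -/
theorem IsHypConst.trans {δ : ℝ} (hδ : IsHypConst S δ) {x y z : Γ} {a : ℝ}
    (h1 : a ≤ gromovProd S x z 1) (h2 : a ≤ gromovProd S z y 1) :
    a - δ ≤ gromovProd S x y 1 :=
  (sub_le_sub_right (le_min h1 h2) δ).trans (hδ.2 x y z)

theorem Ray.wdist_one (γ : Ray S) (n : ℕ) : wdist S (γ.pos n) 1 = n := by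
  have := γ.geodesic 0 n (Nat.zero_le n)
  rw [γ.start] at this
  rw [wdist_comm, this, Nat.sub_zero]

theorem Ray.le_gromovProd (γ : Ray S) {m n k : ℕ} (hm : k ≤ m) (hn : k ≤ n) :
    (k : ℝ) ≤ gromovProd S (γ.pos m) (γ.pos n) 1 := by
  rw [gromovProd, γ.wdist_one, γ.wdist_one]
  rcases le_total m n with h | h
  · rw [γ.geodesic m n h, Nat.cast_sub h]
    have : (k : ℝ) ≤ m := by exact_mod_cast hm
    linarith
  · rw [wdist_comm, γ.geodesic n m h, Nat.cast_sub h]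
    have : (k : ℝ) ≤ n := by exact_mod_cast hn
    linarith

/-- Two rays that fellow travel in the sense of Gromov products represent the same point. -/
theorem Ray.endpoint_eq_of_le_gromovProd (hc : (SimpleGraph.mulCayley S).Connected) {C : ℝ}
    {γ γ' : Ray S} (h : ∀ n : ℕ, (n : ℝ) - C ≤ gromovProd S (γ.pos n) (γ'.pos n) 1) :
    γ.endpoint = γ'.endpoint := by
  refine Quotient.sound ⟨⌈2 * C⌉₊, fun n => ?_⟩
  rw [← (hc _ _).coe_dist_eq_edist]
  have h1 := h n
  rw [gromovProd, γ.wdist_one, γ'.wdist_one] at h1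
  have h2 : (wdist S (γ.pos n) (γ'.pos n) : ℝ) ≤ ⌈2 * C⌉₊ := by
    have := Nat.le_ceil (2 * C)
    linarith
  exact_mod_cast h2

theorem Ray.exists_le_gromovProd_of_endpoint_eq {γ γ' : Ray S} (h : γ.endpoint = γ'.endpoint)
    (hc : (SimpleGraph.mulCayley S).Connected) :
    ∃ C : ℝ, ∀ n : ℕ, (n : ℝ) - C ≤ gromovProd S (γ.pos n) (γ'.pos n) 1 := by
  obtain ⟨C, hC⟩ := Quotient.exact h
  refine ⟨C / 2, fun n => ?_⟩
  have h1 := hC n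
  rw [← (hc _ _).coe_dist_eq_edist] at h1
  have h2 : (wdist S (γ.pos n) (γ'.pos n) : ℝ) ≤ C := by exact_mod_cast h1
  rw [gromovProd, γ.wdist_one, γ'.wdist_one]
  linarith

end Graph

/-! ### Linear convergence of paths of positive speed, and the rays they track -/

section Paths

variable {Γ : Type*} [Group Γ] {S : Set Γ}

/-- Nearest neighbour paths with linear speed `l`. -/
def IsLinearPath (S : Set Γ) (l : ℝ) (x : ℕ → Γ) : Prop :=
  (∀ n, (SimpleGraph.mulCayley S).Adj (x n) (x (n + 1))) ∧
    Tendsto (fun n : ℕ => (wdist S 1 (x n) : ℝ) / n) atTop (𝓝 l)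

/-- Bisecting the time interval makes the loss proportional to the depth `k`, not to the number of
steps. -/
theorem IsHypConst.chain {δ : ℝ} (hδ : IsHypConst S δ) (x : ℕ → Γ) (a : ℝ) (k : ℕ) :
    ∀ n m, n < m → m ≤ n + 2 ^ k →
      (∀ i, n ≤ i → i < m → a ≤ gromovProd S (x i) (x (i + 1)) 1) →
      a - k * δ ≤ gromovProd S (x n) (x m) 1 := by
  induction k with
  | zero =>
    intro n m hnm hm h
    obtain rfl : m = n + 1 := by simp at hm; omega
    simpa using h n le_rfl (by omega)
  | succ k ih =>
    intro n m hnm hm h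
    have h0 := hδ.1
    push_cast
    rcases Nat.lt_or_ge (n + 2 ^ k) m with hlt | hge
    · have h1 := ih n (n + 2 ^ k) (by have := Nat.one_le_two_pow (n := k); omega) le_rfl
        fun i hi hi' => h i hi (hi'.trans hlt)
      have h2 := ih (n + 2 ^ k) m hlt (by rw [pow_succ] at hm; omega)
        fun i hi hi' => h i (by omega) hi'
      have := hδ.trans h1 h2
      linarith
    · have := ih n m hnm hge h
      linarith

theorem eventually_natLog_le {c : ℝ} (hc : 0 < c) :
    ∀ᶠ n : ℕ in atTop, (Nat.log 2 n : ℝ) ≤ c * n := by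
  have hl2 : 0 < Real.log 2 := Real.log_pos one_lt_two
  have h := (Real.isLittleO_log_id_atTop.bound (mul_pos hc hl2)).natCast_atTop
  filter_upwards [h] with n hn
  have h1 : (Nat.log 2 n : ℝ) ≤ Real.logb 2 n := by exact_mod_cast Real.natLog_le_logb n 2
  refine h1.trans ?_
  rw [Real.logb, div_le_iff₀ hl2]
  refine (le_abs_self _).trans (hn.trans_eq ?_)
  simp only [id, Real.norm_eq_abs, Nat.abs_cast]
  ring

theorem IsLinearPath.eventually_between {l : ℝ} {x : ℕ → Γ} (hx : IsLinearPath S l x) {a b : ℝ}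
    (ha : a < l) (hb : l < b) :
    ∀ᶠ n : ℕ in atTop, a * n ≤ wdist S (x n) 1 ∧ (wdist S (x n) 1 : ℝ) ≤ b * n := by
  filter_upwards [hx.2.eventually (Ioo_mem_nhds ha hb), eventually_gt_atTop 0] with n hn hn0
  have h0 : (0 : ℝ) < n := by exact_mod_cast hn0
  rw [wdist_comm]
  exact ⟨((lt_div_iff₀ h0).1 hn.1).le, ((div_lt_iff₀ h0).1 hn.2).le⟩

/-- A nearest neighbour path with positive speed converges linearly fast. -/
theorem IsLinearPath.eventually_le_gromovProd (hc : (SimpleGraph.mulCayley S).Connected)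
    {δ : ℝ} (hδ : IsHypConst S δ) {l : ℝ} (hl : 0 < l) {x : ℕ → Γ} (hx : IsLinearPath S l x)
    {a : ℝ} (ha : a < l) :
    ∀ᶠ n : ℕ in atTop, ∀ m, n ≤ m → a * n ≤ gromovProd S (x n) (x m) 1 := by
  wlog ha0 : 0 < a generalizing a
  · filter_upwards [this (half_lt_self hl) (half_pos hl)] with n hn m hm
    refine le_trans ?_ (hn m hm)
    gcongr
    linarith
  -- The gap between `a₂` and `a₁` pays for the logarithmic loss of bisection, the gap between `a₁`
  -- and `a` for the `δ` lost in joining dyadic blocks.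
  obtain ⟨a₁, h1, h1'⟩ := exists_between ha
  obtain ⟨a₂, h2, h2'⟩ := exists_between h1'
  have hδ0 := hδ.1
  have hlog := eventually_natLog_le (c := (a₂ - a₁) / 2 / (δ + 1))
    (div_pos (by linarith) (by linarith))
  have hlarge : ∀ c : ℝ, 0 < c → ∀ᶠ n : ℕ in atTop, δ + 1 ≤ c * n := fun c hc =>
    (tendsto_natCast_atTop_atTop.const_mul_atTop hc).eventually_ge_atTop _
  obtain ⟨N, hN⟩ := eventually_atTop.1 ((hx.eventually_between h2' (lt_add_one l)).and
    (hlog.and ((hlarge _ (show 0 < (a₂ - a₁) / 2 by linarith)).and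
    ((hlarge _ (sub_pos.2 h1)).and ((hlarge _ ha0).and (eventually_gt_atTop 0))))))
  have hstep : ∀ n, N ≤ n → a₂ * n - 1 ≤ gromovProd S (x n) (x (n + 1)) 1 := by
    intro n hn
    have hw := (hN n hn).1.1
    have hd : wdist S (x n) (x (n + 1)) = 1 := wdist_of_adj (hx.1 n)
    have ht := wdist_triangle hc (x n) (x (n + 1)) 1
    rw [hd] at ht
    have ht' : (wdist S (x n) 1 : ℝ) ≤ 1 + wdist S (x (n + 1)) 1 := by exact_mod_cast ht
    rw [gromovProd, hd]
    push_cast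
    linarith
  have hdouble : ∀ n, N ≤ n → ∀ m, n < m → m ≤ 2 * n →
      a₁ * n ≤ gromovProd S (x n) (x m) 1 := by
    intro n hn m hnm hm
    obtain ⟨-, hlog, hδn, -, -, hn0⟩ := hN n hn
    have hpow : n ≤ 2 ^ (Nat.log 2 n + 1) := (Nat.lt_pow_succ_log_self one_lt_two n).le
    have := hδ.chain x (a₂ * n - 1) (Nat.log 2 n + 1) n m hnm (by omega) fun i hi _ => by
      refine le_trans ?_ (hstep i (hn.trans hi))
      have : (n : ℝ) ≤ i := by exact_mod_cast hi
      have : a₂ * n ≤ a₂ * i := mul_le_mul_of_nonneg_left this (by linarith)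
      linarith
    have h3 : (Nat.log 2 n : ℝ) * (δ + 1) ≤ (a₂ - a₁) / 2 * n := by
      have := mul_le_mul_of_nonneg_right hlog (show 0 ≤ δ + 1 by linarith)
      refine this.trans_eq ?_
      field_simp
    have h4 : (Nat.log 2 n : ℝ) * δ ≤ (Nat.log 2 n : ℝ) * (δ + 1) := by
      gcongr; linarith
    push_cast at this
    linarith
  refine eventually_atTop.2 ⟨N, fun n hn m hm => ?_⟩
  induction hk : m - n using Nat.strong_induction_on generalizing n with
  | _ k ih =>
    obtain ⟨hw, -, -, h4, h5, hn0⟩ := hN n hn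
    have hnR : (0 : ℝ) ≤ n := Nat.cast_nonneg n
    have han : a * n ≤ a₁ * n := by gcongr
    rcases hm.eq_or_lt with rfl | hlt
    · rw [gromovProd, wdist_self]
      have : a₁ * n ≤ a₂ * n := by gcongr
      push_cast
      linarith [hw.1]
    rcases Nat.lt_or_ge (2 * n) m with h | h
    -- Going through `x (2 * n)`, the induction gives `2 * a * n`, which exceeds the goal by `a * n
    -- ≥ δ`; so losses do not accumulate over the blocks.
    · have h6 := ih (m - 2 * n) (by omega) (2 * n) (by omega) h.le rfl
      have h7 := hdouble n hn (2 * n) (by omega) le_rfl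
      push_cast at h6
      have := hδ.trans (a := a * n + δ) (h7.trans' (by linarith)) (h6.trans' (by linarith))
      linarith
    · exact han.trans (hdouble n hn m hlt h)

/-- A choice of a geodesic segment from `1` to every vertex. -/
structure IsGeodesicSystem (S : Set Γ) (c : Γ → ℕ → Γ) : Prop where
  start : ∀ g, c g 0 = 1
  geodesic : ∀ g i j, i ≤ j → j ≤ wdist S g 1 → wdist S (c g i) (c g j) = j - i
  end_eq : ∀ g, c g (wdist S g 1) = g
  wdist_le : ∀ g i, wdist S (c g i) 1 ≤ i

theorem exists_isGeodesicSystem (hc : (SimpleGraph.mulCayley S).Connected) :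
    ∃ c : Γ → ℕ → Γ, IsGeodesicSystem S c := by
  choose c h0 h1 h2 h3 using exists_geodesic (S := S) hc
  exact ⟨c, h0, h2, h1, h3⟩

theorem IsGeodesicSystem.le_gromovProd {c : Γ → ℕ → Γ} (hcs : IsGeodesicSystem S c) (g : Γ)
    {i : ℕ} (hi : i ≤ wdist S g 1) : (i : ℝ) ≤ gromovProd S (c g i) g 1 := by
  have h1 := hcs.geodesic g i _ hi le_rfl
  have h2 := hcs.geodesic g 0 i (Nat.zero_le i) hi
  rw [hcs.end_eq] at h1
  rw [hcs.start, wdist_comm] at h2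
  rw [gromovProd, h1, h2, Nat.sub_zero, Nat.cast_sub hi]
  linarith

/-- Compactness of the space of geodesic rays. -/
theorem IsGeodesicSystem.exists_ray (hfin : S.Finite) (hc : (SimpleGraph.mulCayley S).Connected)
    {c : Γ → ℕ → Γ} (hcs : IsGeodesicSystem S c) {ι : Type*} (𝒰 : Ultrafilter ι) {x : ι → Γ}
    (hx : Tendsto (fun n => wdist S (x n) 1) 𝒰 atTop) :
    ∃ γ : Ray S, ∀ k, ∀ᶠ n in 𝒰, ∀ i ≤ k, c (x n) i = γ.pos i := by
  -- The `i`-th vertices lie in a finite ball, so the ultrafilter selects one of them.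
  have h1 : ∀ i, ∃ g : Γ, ∀ᶠ n in 𝒰, c (x n) i = g := by
    intro i
    have : ∀ᶠ n in 𝒰, ∃ g ∈ {g : Γ | wdist S g 1 ≤ i}, c (x n) i = g :=
      Eventually.of_forall fun n => ⟨_, hcs.wdist_le _ _, rfl⟩
    obtain ⟨g, -, hg⟩ :=
      (Ultrafilter.eventually_exists_mem_iff (finite_ball hfin hc i)).1 this
    exact ⟨g, hg⟩
  choose g hg using h1
  have h2 : ∀ k, ∀ᶠ n in 𝒰, ∀ i ≤ k, c (x n) i = g i := fun k =>
    (eventually_all_finite (Set.finite_Iic k)).2 fun i _ => hg i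
  refine ⟨⟨g, ?_, fun m n hmn => ?_⟩, h2⟩
  · obtain ⟨n, hn⟩ := (hg 0).exists
    rw [← hn, hcs.start]
  · obtain ⟨k, hk, hk'⟩ := ((h2 n).and (hx.eventually_ge_atTop n)).exists
    rw [← hk m hmn, ← hk n le_rfl]
    exact hcs.geodesic _ _ _ hmn hk'

theorem IsLinearPath.tendsto_wdist {l : ℝ} (hl : 0 < l) {x : ℕ → Γ} (hx : IsLinearPath S l x) :
    Tendsto (fun n => wdist S (x n) 1) atTop atTop := by
  rw [← tendsto_natCast_atTop_iff (R := ℝ)]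
  refine tendsto_atTop_mono' _ ?_
    (tendsto_natCast_atTop_atTop.const_mul_atTop (half_pos hl) : Tendsto (fun n : ℕ => l / 2 * n) _ _)
  filter_upwards [hx.eventually_between (half_lt_self hl) (lt_add_one l)] with n hn using hn.1

/-- A limit of the segments from `1` to `x n` is tracked by `x`. -/
theorem IsLinearPath.tracks (hc : (SimpleGraph.mulCayley S).Connected)
    {δ : ℝ} (hδ : IsHypConst S δ) {l : ℝ} (hl : 0 < l) {x : ℕ → Γ} (hx : IsLinearPath S l x)
    {c : Γ → ℕ → Γ} (hcs : IsGeodesicSystem S c) {γ : Ray S}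
    (hγ : ∀ k, ∃ᶠ n in atTop, ∀ i ≤ k, c (x n) i = γ.pos i) : Tracks S l x γ.endpoint := by
  refine ⟨γ, rfl, ?_⟩
  rw [Metric.tendsto_nhds]
  intro ε hε
  have hlarge : ∀ᶠ n : ℕ in atTop, 2 + 2 * δ + 1 ≤ ε / 4 * n :=
    (tendsto_natCast_atTop_atTop.const_mul_atTop (by linarith)).eventually_ge_atTop _
  filter_upwards [hx.eventually_le_gromovProd hc hδ hl (show l - ε / 4 < l by linarith),
    hx.eventually_between (sub_one_lt l) (show l < l + ε / 4 by linarith), hlarge,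
    eventually_gt_atTop 0] with n h1 h2 h3 h0
  have hn0 : (0 : ℝ) < n := by exact_mod_cast h0
  set R := ⌊l * n⌋₊
  have hR1 : (R : ℝ) ≤ l * n := Nat.floor_le (by positivity)
  have hR2 : l * n < R + 1 := Nat.lt_floor_add_one _
  -- A later `x m` whose segment follows `γ` up to time `R` joins `x n` to `γ.pos R`. The product is
  -- then almost `l * n`, as are both distances to `1`, so the two points are close.
  obtain ⟨m, hm, hm1, hm2⟩ := ((hγ R).and_eventually
    ((eventually_ge_atTop n).and ((hx.tendsto_wdist hl).eventually_ge_atTop R))).exists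
  have h4 : (R : ℝ) ≤ gromovProd S (x m) (γ.pos R) 1 := by
    rw [← hm R le_rfl, gromovProd_comm]
    exact hcs.le_gromovProd _ hm2
  have h5 := hδ.trans (a := (l - ε / 4) * n - 1) ((h1 m hm1).trans' (by linarith))
    (h4.trans' (by nlinarith))
  rw [gromovProd, γ.wdist_one] at h5
  rw [Real.dist_0_eq_abs, abs_of_nonneg (by positivity), div_lt_iff₀ hn0]
  nlinarith [h2.2]

/-- An error below `l / 2 * m` at distance about `l * m` from `1` already forces a product of at
least about `l / 2 * m`. -/
theorem Tracks.eventually_le_gromovProd {δ : ℝ} (hc : (SimpleGraph.mulCayley S).Connected)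
    (hδ : IsHypConst S δ) {l : ℝ} (hl : 0 < l) {x : ℕ → Γ} {γ : Ray S}
    (hγ : Tendsto (fun n : ℕ => (wdist S (x n) (γ.pos ⌊l * n⌋₊) : ℝ) / n) atTop (𝓝 0)) (K : ℝ) :
    ∀ᶠ m in atTop, ∀ᶠ k in atTop, K ≤ gromovProd S (γ.pos k) (x m) 1 := by
  have hlarge : ∀ᶠ n : ℕ in atTop, K + δ + 1 ≤ l / 2 * n :=
    (tendsto_natCast_atTop_atTop.const_mul_atTop (by linarith)).eventually_ge_atTop _
  filter_upwards [hγ.eventually_lt_const (half_pos hl), hlarge, eventually_gt_atTop 0]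
    with m h1 h2 h0
  have hm0 : (0 : ℝ) < m := by exact_mod_cast h0
  filter_upwards [eventually_ge_atTop ⌊l * m⌋₊] with k hk
  rw [div_lt_iff₀ hm0] at h1
  have h3 := γ.le_gromovProd hk le_rfl
  have hR2 : l * m < ⌊l * m⌋₊ + 1 := Nat.lt_floor_add_one _
  have ht := wdist_triangle hc (γ.pos ⌊l * m⌋₊) (x m) 1
  rw [γ.wdist_one, wdist_comm] at ht
  have ht' : (⌊l * m⌋₊ : ℝ) ≤ wdist S (x m) (γ.pos ⌊l * m⌋₊) + wdist S (x m) 1 := by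
    exact_mod_cast ht
  have h4 : (⌊l * m⌋₊ : ℝ) - l / 2 * m ≤ gromovProd S (γ.pos ⌊l * m⌋₊) (x m) 1 := by
    rw [gromovProd, γ.wdist_one, wdist_comm (γ.pos _) (x m)]
    linarith
  have := hδ.trans (a := K + δ) (h3.trans' (by nlinarith)) (h4.trans' (by nlinarith))
  linarith

/-- The chain `γ n`, `γ k`, `x m`, `γ' k`, `γ' n` with `m`, `k` large keeps the product within a
constant of `n`, so the rays stay at bounded distance. -/
theorem Tracks.unique {δ : ℝ} (hc : (SimpleGraph.mulCayley S).Connected)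
    (hδ : IsHypConst S δ) {l : ℝ} (hl : 0 < l) {x : ℕ → Γ} {ξ ξ' : Boundary S}
    (h : Tracks S l x ξ) (h' : Tracks S l x ξ') : ξ = ξ' := by
  obtain ⟨γ, rfl, hγ⟩ := h
  obtain ⟨γ', rfl, hγ'⟩ := h'
  refine Ray.endpoint_eq_of_le_gromovProd hc (C := 4 * δ) fun n => ?_
  have hδ0 := hδ.1
  obtain ⟨m, h1, h2⟩ := ((Tracks.eventually_le_gromovProd hc hδ hl hγ n).and
    (Tracks.eventually_le_gromovProd hc hδ hl hγ' n)).exists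
  obtain ⟨k, h1, h2, hk⟩ := (h1.and (h2.and (eventually_ge_atTop n))).exists
  have h3 := γ.le_gromovProd (le_refl n) hk
  have h4 := γ'.le_gromovProd hk (le_refl n)
  rw [gromovProd_comm] at h2
  have h5 := hδ.trans h3 h1
  have h6 := hδ.trans h2 h4
  have := hδ.trans h5 h6
  linarith

end Paths

/-! ### The boundary product and its topology -/

section BoundaryTopology

variable {Γ : Type*} [Group Γ] {S : Set Γ}

theorem le_bdryProd {γ γ' : Ray S} {a : ℝ} {N : ℕ}
    (h : ∀ n, N ≤ n → ∀ m, N ≤ m → a ≤ gromovProd S (γ.pos n) (γ'.pos m) 1) :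
    (a : EReal) ≤ bdryProd γ.endpoint γ'.endpoint := by
  refine le_trans ?_ (le_iSup₂_of_le γ γ' (le_iSup₂_of_le rfl rfl le_rfl))
  refine le_liminf_of_le (by isBoundedDefault) ?_
  refine eventually_atTop_prod_self'.2 ⟨N, fun n hn m hm => ?_⟩
  exact EReal.coe_le_coe_iff.2 (h n hn m hm)

theorem exists_of_lt_bdryProd {ξ η : Boundary S} {a : ℝ} (h : (a : EReal) < bdryProd ξ η) :
    ∃ γ γ' : Ray S, γ.endpoint = ξ ∧ γ'.endpoint = η ∧
      ∃ N, ∀ n, N ≤ n → ∀ m, N ≤ m → a ≤ gromovProd S (γ.pos n) (γ'.pos m) 1 := by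
  simp only [bdryProd, lt_iSup_iff] at h
  obtain ⟨γ, γ', h1, h2, h3⟩ := h
  obtain ⟨N, hN⟩ := eventually_atTop_prod_self'.1 (eventually_lt_of_lt_liminf h3)
  exact ⟨γ, γ', h1, h2, N, fun n hn m hm => (EReal.coe_lt_coe_iff.1 (hN n hn m hm)).le⟩

theorem bdryProd_self (ξ : Boundary S) : bdryProd ξ ξ = ⊤ := by
  obtain ⟨γ, rfl⟩ := Quotient.exists_rep ξ
  rw [EReal.eq_top_iff_forall_lt]
  intro y
  have hy : y < ((⌈y⌉₊ + 1 : ℕ) : ℝ) := by push_cast; linarith [Nat.le_ceil y]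
  refine (EReal.coe_lt_coe_iff.2 hy).trans_le ?_
  exact le_bdryProd (γ := γ) (γ' := γ) fun n hn m hm => γ.le_gromovProd hn hm

theorem bdryProd_comm_le (ξ η : Boundary S) : bdryProd ξ η ≤ bdryProd η ξ := by
  refine le_of_forall_lt fun c hc => ?_
  obtain ⟨r, h1, h2⟩ := EReal.lt_iff_exists_real_btwn.1 hc
  obtain ⟨γ, γ', rfl, rfl, N, hN⟩ := exists_of_lt_bdryProd h2
  exact h1.trans_le (le_bdryProd (N := N) fun n hn m hm => by
    rw [gromovProd_comm]; exact hN m hm n hn)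

theorem bdryProd_comm (ξ η : Boundary S) : bdryProd ξ η = bdryProd η ξ :=
  le_antisymm (bdryProd_comm_le ξ η) (bdryProd_comm_le η ξ)

/-- The two products may be realised by different rays towards `η`. These stay at bounded distance,
so far out their mutual product exceeds `a` and costs only the second `δ`. -/
theorem bdryProd_trans (hc : (SimpleGraph.mulCayley S).Connected) {δ : ℝ} (hδ : IsHypConst S δ)
    {ξ η ζ : Boundary S} {a : ℝ} (h1 : (a : EReal) < bdryProd ξ η)
    (h2 : (a : EReal) < bdryProd η ζ) : ((a - 2 * δ : ℝ) : EReal) ≤ bdryProd ξ ζ := by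
  obtain ⟨γ₁, γ₂, rfl, rfl, N, hN⟩ := exists_of_lt_bdryProd h1
  obtain ⟨γ₃, γ₄, h3, rfl, M, hM⟩ := exists_of_lt_bdryProd h2
  obtain ⟨C, hC⟩ := Ray.exists_le_gromovProd_of_endpoint_eq h3 hc
  have hδ0 := hδ.1
  obtain ⟨k, hk⟩ := exists_nat_ge (a + C)
  set K := max k (max N M)
  have hkK : (k : ℝ) ≤ K := by exact_mod_cast le_max_left _ _
  refine le_bdryProd (N := K) fun n hn m hm => ?_
  have h4 := hN n (by omega) K (by omega)
  have h5 := hM K (by omega) m (by omega)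
  have h6 := hC K
  rw [gromovProd_comm] at h6
  have h7 := hδ.trans h4 (h6.trans' (by linarith))
  have := hδ.trans h7 (h5.trans' (by linarith))
  linarith

theorem mem_bdryBall_exp_neg {ξ η : Boundary S} {a : ℝ} :
    η ∈ bdryBall ξ (Real.exp (-a)) ↔ (a : EReal) < bdryProd ξ η := by
  rw [bdryBall, Set.mem_ofPred_eq, rho, ← EReal.exp_coe, EReal.exp_lt_exp_iff, EReal.coe_neg,
    EReal.neg_lt_neg_iff]

theorem bdryBall_mono (ξ : Boundary S) {r s : ℝ} (h : r ≤ s) : bdryBall ξ r ⊆ bdryBall ξ s :=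
  fun _ hη => lt_of_lt_of_le hη (ENNReal.ofReal_le_ofReal h)

theorem isOpen_boundary_iff {U : Set (Boundary S)} :
    IsOpen U ↔ ∀ ξ ∈ U, ∃ a : ℝ, ∀ η, (a : EReal) < bdryProd ξ η → η ∈ U := by
  constructor
  · intro h ξ hξ
    obtain ⟨r, hr, h⟩ := h ξ hξ
    refine ⟨-Real.log r, fun η hη => h ?_⟩
    rw [← mem_bdryBall_exp_neg, neg_neg, Real.exp_log hr] at hη
    exact hη
  · intro h ξ hξ
    obtain ⟨a, h⟩ := h ξ hξ
    exact ⟨Real.exp (-a), Real.exp_pos _, fun η hη => h η (mem_bdryBall_exp_neg.1 hη)⟩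

/-- Balls of a quasi-metric need not be open. By `bdryProd_trans`, however, the points having some
ball inside `A` form an open set, so they are interior. -/
theorem mem_interior_of_forall_lt (hc : (SimpleGraph.mulCayley S).Connected) {δ : ℝ}
    (hδ : IsHypConst S δ) {A : Set (Boundary S)} {ξ : Boundary S} {a : ℝ}
    (h : ∀ η, (a : EReal) < bdryProd ξ η → η ∈ A) : ξ ∈ interior A := by
  let U : Set (Boundary S) := {ξ | ∃ a : ℝ, ∀ η, (a : EReal) < bdryProd ξ η → η ∈ A}
  have hU : IsOpen U := by
    refine isOpen_boundary_iff.2 fun ξ ⟨a, h⟩ => ⟨a + 2 * δ + 1, fun η hη => ?_⟩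
    refine ⟨a + 2 * δ + 1, fun ζ hζ => h ζ ?_⟩
    refine lt_of_lt_of_le ?_ (bdryProd_trans hc hδ hη hζ)
    exact EReal.coe_lt_coe_iff.2 (by linarith)
  have hUA : U ⊆ A := fun ξ ⟨a, h⟩ => h ξ (by rw [bdryProd_self]; exact EReal.coe_lt_top a)
  exact interior_maximal hUA hU ⟨a, h⟩

end BoundaryTopology

/-! ### Measurability of the boundary map -/

section BoundaryMap

variable {Γ : Type*} [Group Γ] {S : Set Γ}

/-- The endpoint of a ray depends continuously on the ray. -/
theorem exists_forall_endpoint_mem {δ : ℝ} (hδ : IsHypConst S δ) {U : Set (Boundary S)}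
    (hU : IsOpen U) {γ : Ray S} (hγ : γ.endpoint ∈ U) :
    ∃ k : ℕ, ∀ γ' : Ray S, (∀ i ≤ k, γ'.pos i = γ.pos i) → γ'.endpoint ∈ U := by
  obtain ⟨a, ha⟩ := isOpen_boundary_iff.1 hU _ hγ
  obtain ⟨k, hk⟩ := exists_nat_gt (a + δ)
  refine ⟨k, fun γ' h => ha _ ?_⟩
  refine lt_of_lt_of_le (EReal.coe_lt_coe_iff.2 (show a < k - δ by linarith)) ?_
  refine le_bdryProd (N := k) fun n hn m hm => ?_
  have h1 := γ.le_gromovProd hn le_rfl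
  have h2 := γ'.le_gromovProd le_rfl hm
  rw [h k le_rfl] at h2
  exact hδ.trans h1 h2

/-- Taking the limit only along times satisfying `p` allows the initial piece of the ray to be
prescribed. -/
theorem IsLinearPath.exists_ray (hfin : S.Finite) (hc : (SimpleGraph.mulCayley S).Connected)
    {l : ℝ} (hl : 0 < l) {x : ℕ → Γ} (hx : IsLinearPath S l x)
    {c : Γ → ℕ → Γ} (hcs : IsGeodesicSystem S c) {p : ℕ → Prop} (hp : ∃ᶠ n in atTop, p n) :
    ∃ γ : Ray S, ∀ k, ∃ᶠ n in atTop, p n ∧ ∀ i ≤ k, c (x n) i = γ.pos i := by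
  have : (atTop ⊓ 𝓟 {n | p n}).NeBot := frequently_mem_iff_neBot.1 hp
  obtain ⟨𝒰, h𝒰⟩ := Ultrafilter.exists_le (atTop ⊓ 𝓟 {n | p n})
  obtain ⟨γ, hγ⟩ := hcs.exists_ray hfin hc 𝒰
    ((hx.tendsto_wdist hl).mono_left (h𝒰.trans inf_le_left))
  refine ⟨γ, fun k => ?_⟩
  have hp' : ∀ᶠ n in 𝒰, p n := le_principal_iff.1 (h𝒰.trans inf_le_right)
  exact ((hp'.and (hγ k)).frequently).filter_mono (h𝒰.trans inf_le_left)

/-- The boundary map, defined on all paths. -/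
theorem exists_boundaryMap [MeasurableSpace Γ] [DiscreteMeasurableSpace Γ] [Nonempty (Ray S)]
    (hfin : S.Finite) (hc : (SimpleGraph.mulCayley S).Connected) {δ : ℝ} (hδ : IsHypConst S δ)
    {l : ℝ} (hl : 0 < l) :
    ∃ bnd : (ℕ → Γ) → Boundary S, Measurable bnd ∧
      ∀ x, IsLinearPath S l x → Tracks S l x (bnd x) := by
  classical
  have hcount := countable_of_connected hfin hc
  obtain ⟨c, hcs⟩ := exists_isGeodesicSystem hc
  have hex : ∀ x, IsLinearPath S l x → ∃ ξ, Tracks S l x ξ := by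
    intro x hx
    obtain ⟨γ, hγ⟩ := hx.exists_ray hfin hc hl hcs (p := fun _ => True)
      (Eventually.of_forall fun _ => trivial).frequently
    exact ⟨_, hx.tracks hc hδ hl hcs fun k => (hγ k).mono fun n hn => hn.2⟩
  let ξ₀ : Boundary S := (Classical.arbitrary (Ray S)).endpoint
  have : Nonempty (Boundary S) := ⟨ξ₀⟩
  choose! f hf using hex
  -- The choice `f` carries no measurability by itself; uniqueness of the tracked point supplies it
  -- on linear paths. Elsewhere the value is a constant.
  refine ⟨fun x => if IsLinearPath S l x then f x else ξ₀, ?_, fun x hx => by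
    simpa only [if_pos hx] using hf x hx⟩
  have hmeas : MeasurableSet {x : ℕ → Γ | IsLinearPath S l x} := by
    refine MeasurableSet.inter
      (s₁ := {x : ℕ → Γ | ∀ n, (SimpleGraph.mulCayley S).Adj (x n) (x (n + 1))}) ?_ (measurableSet_tendsto _ fun n => ?_)
    · have : {x : ℕ → Γ | ∀ n, (SimpleGraph.mulCayley S).Adj (x n) (x (n + 1))} =
          ⋂ n, (fun x : ℕ → Γ => (x n, x (n + 1))) ⁻¹'
            {q : Γ × Γ | (SimpleGraph.mulCayley S).Adj q.1 q.2} := by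
        ext x; simp
      rw [this]
      refine MeasurableSet.iInter fun n => ?_
      exact (by fun_prop : Measurable fun x : ℕ → Γ => (x n, x (n + 1)))
        (MeasurableSet.of_discrete)
    · exact (Measurable.of_discrete (f := fun g : Γ => (wdist S 1 g : ℝ) / n)).comp
        (measurable_pi_apply n)
  refine measurable_of_isOpen fun U hU => ?_
  -- For linear paths this countable union is the preimage of `U`: some initial piece forces the
  -- endpoint into `U` and recurs in infinitely many segments to `x n`.
  have hset : MeasurableSet (⋃ q : {q : ℕ × Γ | ∀ γ : Ray S,
      (∀ i ≤ q.1, γ.pos i = c q.2 i) → γ.endpoint ∈ U},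
      {x : ℕ → Γ | ∃ᶠ n in atTop, ∀ i ≤ q.1.1, c (x n) i = c q.1.2 i}) := by
    refine MeasurableSet.iUnion fun q => ?_
    have : {x : ℕ → Γ | ∃ᶠ n in atTop, ∀ i ≤ q.1.1, c (x n) i = c q.1.2 i} =
        limsup (fun n => (fun x : ℕ → Γ => x n) ⁻¹'
          {g | ∀ i ≤ q.1.1, c g i = c q.1.2 i}) atTop := by
      ext x
      simp [mem_limsup_iff_frequently_mem]
    rw [this]
    exact MeasurableSet.measurableSet_limsup fun n =>
      (measurable_pi_apply n) MeasurableSet.of_discrete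
  refine ((hmeas.inter hset).union (hmeas.compl.inter (MeasurableSet.const (ξ₀ ∈ U)))).congr ?_
  ext x
  by_cases hx : IsLinearPath S l x
  swap
  · simp [hx]
  simp only [Set.mem_union, Set.mem_inter_iff, Set.mem_ofPred_eq, hx, true_and,
    Set.mem_compl_iff, not_true, false_and, or_false, Set.mem_preimage, if_true,
    Set.mem_iUnion, Subtype.exists, exists_prop, Prod.exists]
  constructor
  · rintro ⟨k, g, h1, h2⟩
    obtain ⟨γ, hγ⟩ := hx.exists_ray hfin hc hl hcs h2
    have h3 := hx.tracks hc hδ hl hcs fun k => (hγ k).mono fun n hn => hn.2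
    rw [Tracks.unique hc hδ hl (hf x hx) h3]
    refine h1 γ fun i hi => ?_
    obtain ⟨n, hn, hn'⟩ := (hγ k).exists
    rw [← hn' i hi, hn i hi]
  · intro h
    obtain ⟨γ, hγ⟩ := hx.exists_ray hfin hc hl hcs (p := fun _ => True)
      (Eventually.of_forall fun _ => trivial).frequently
    have h3 := hx.tracks hc hδ hl hcs fun k => (hγ k).mono fun n hn => hn.2
    rw [Tracks.unique hc hδ hl (hf x hx) h3] at h
    obtain ⟨k, hk⟩ := exists_forall_endpoint_mem hδ hU h
    obtain ⟨n, -, hn⟩ := (hγ k).exists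
    refine ⟨k, x n, fun γ' h => hk γ' fun i hi => by rw [h i hi, hn i hi], ?_⟩
    exact (hγ k).mono fun m hm i hi => by rw [hm.2 i hi, hn i hi]

end BoundaryMap

/-! ### One-time marginals and a conditional Borel–Cantelli estimate -/

section WalkDistribution

variable {Γ : Type*} [Group Γ] [MeasurableSpace Γ] [DiscreteMeasurableSpace Γ]

theorem pathMeasure_step [Countable Γ] (P : Γ → PMF Γ) (n : ℕ) (g g' : Γ) :
    pathMeasure P {x | x n = g ∧ x (n + 1) = g'} = pathMeasure P {x | x n = g} * P g g' := by
  let A : Set (Finset.Iic n → Γ) := (fun w => w ⟨n, Finset.mem_Iic.2 le_rfl⟩) ⁻¹' {g}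
  have hA : MeasurableSet A :=
    measurable_pi_apply (⟨n, Finset.mem_Iic.2 le_rfl⟩ : Finset.Iic n) (measurableSet_singleton g)
  have hset : {x : ℕ → Γ | x n = g ∧ x (n + 1) = g'} =
      (fun x : ℕ → Γ => (Preorder.frestrictLe (π := fun _ : ℕ => Γ) n x, x (n + 1))) ⁻¹'
        (A ×ˢ {g'}) := rfl
  have hset' : {x : ℕ → Γ | x n = g} = Preorder.frestrictLe (π := fun _ : ℕ => Γ) n ⁻¹' A := rfl
  have key := Kernel.map_frestrictLe_trajMeasure_compProd_eq_map_trajMeasure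
    (X := fun _ : ℕ => Γ) (μ₀ := Measure.dirac (1 : Γ)) (κ := stepKernel P) (a := n)
  rw [hset, ← Measure.map_apply (by fun_prop) (hA.prod (measurableSet_singleton _)), hset',
    ← Measure.map_apply (by fun_prop) hA]
  rw [pathMeasure, ← key, Measure.compProd_apply_prod hA (measurableSet_singleton _),
    setLIntegral_congr_fun (g := fun _ => P g g') hA fun w hw => ?_, setLIntegral_const, mul_comm]
  change (P (w _)).toMeasure {g'} = P g g'
  rw [PMF.toMeasure_apply_singleton _ _ (measurableSet_singleton _), show w _ = g from hw]

theorem pathMeasure_eq_nStep [Countable Γ] (P : Γ → PMF Γ) (n : ℕ) (g : Γ) :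
    pathMeasure P {x | x n = g} = nStep P n 1 g := by
  classical
  induction n generalizing g with
  | zero =>
    have := pathMeasure_cylinder P (fun _ => g) 0
    simp only [Nat.le_zero, forall_eq, Finset.range_zero, Finset.prod_empty, mul_one] at this
    rw [this, nStep, PMF.pure_apply]
  | succ n ih =>
    have hunion : {x : ℕ → Γ | x (n + 1) = g} =
        ⋃ g', {x : ℕ → Γ | x n = g' ∧ x (n + 1) = g} := by
      ext x; simp
    have hm : ∀ (k : ℕ) (g' : Γ), MeasurableSet {x : ℕ → Γ | x k = g'} := fun k g' =>
      show MeasurableSet ((fun x : ℕ → Γ => x k) ⁻¹' {g'}) from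
        measurable_pi_apply k (measurableSet_singleton g')
    rw [hunion, measure_iUnion (f := fun g' => {x : ℕ → Γ | x n = g' ∧ x (n + 1) = g})
      (fun g₁ g₂ hne => Set.disjoint_left.2 fun x h1 h2 =>
      hne (h1.1.symm.trans h2.1)) fun g' => (hm n g').inter (hm (n + 1) g), nStep, PMF.bind_apply]
    exact tsum_congr fun g' => by rw [pathMeasure_step, ih]

theorem ae_adj [Countable Γ] {S : Set Γ} {P : Γ → PMF Γ} (hP : IsNearestNeighbor S P) :
    ∀ᵐ x ∂pathMeasure P, ∀ n, (SimpleGraph.mulCayley S).Adj (x n) (x (n + 1)) := by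
  refine ae_all_iff.2 fun n => ?_
  have : ∀ q : Γ × Γ, ∀ᵐ x ∂pathMeasure P, x n = q.1 ∧ x (n + 1) = q.2 →
      (SimpleGraph.mulCayley S).Adj q.1 q.2 := by
    intro q
    by_cases h : (SimpleGraph.mulCayley S).Adj q.1 q.2
    · exact Eventually.of_forall fun _ _ => h
    · have h0 : pathMeasure P {x | x n = q.1 ∧ x (n + 1) = q.2} = 0 := by
        rw [pathMeasure_step, not_ne_iff.1 (mt (hP q.1 q.2) h), mul_zero]
      filter_upwards [measure_eq_zero_iff_ae_notMem.1 h0] with x hx hx'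
      exact (hx hx').elim
  filter_upwards [ae_all_iff.2 this] with x hx
  exact hx (x n, x (n + 1)) ⟨rfl, rfl⟩

/-- Needed because `Real.log 0 = 0`: the entropy limit alone bounds nothing where the probability
vanishes. -/
theorem ae_nStep_ne_zero [Countable Γ] (P : Γ → PMF Γ) :
    ∀ᵐ x ∂pathMeasure P, ∀ n, nStep P n 1 (x n) ≠ 0 := by
  refine ae_all_iff.2 fun n => ?_
  have : ∀ g : Γ, ∀ᵐ x ∂pathMeasure P, x n = g → nStep P n 1 g ≠ 0 := by
    intro g
    by_cases h : nStep P n 1 g = 0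
    · have h0 : pathMeasure P {x | x n = g} = 0 := by rw [pathMeasure_eq_nStep, h]
      filter_upwards [measure_eq_zero_iff_ae_notMem.1 h0] with x hx hx'
      exact (hx hx').elim
    · exact Eventually.of_forall fun _ _ => h
  filter_upwards [ae_all_iff.2 this] with x hx
  exact hx (x n) rfl

/-- Along almost every path in `A`, the conditional probability of `A` given the position at time
`n` does not decay exponentially. -/
theorem ae_eventually_mul_nStep_le [Countable Γ] (P : Γ → PMF Γ) (A : Set (ℕ → Γ)) {ε : ℝ}
    (hε : 0 < ε) :
    ∀ᵐ x ∂pathMeasure P, x ∈ A → ∀ᶠ n : ℕ in atTop,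
      ENNReal.ofReal (Real.exp (-(ε * n))) * nStep P n 1 (x n) ≤
        pathMeasure P (A ∩ {z | z n = x n}) := by
  let s : ℕ → Set (ℕ → Γ) := fun n => {x | x ∈ A ∧ pathMeasure P (A ∩ {z | z n = x n}) <
      ENNReal.ofReal (Real.exp (-(ε * n))) * nStep P n 1 (x n)}
  -- Each bad position `g` contributes at most `exp (-ε * n)` times its probability, and
  -- probabilities sum to one. Only subadditivity enters, so `A` need not be measurable.
  have hs : ∀ n, pathMeasure P (s n) ≤ ENNReal.ofReal (Real.exp (-ε)) ^ n := by
    intro n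
    have hunion : s n = ⋃ g, s n ∩ {x | x n = g} := by
      ext x; simp
    rw [hunion, ← ENNReal.ofReal_pow (Real.exp_pos _).le, ← Real.exp_nat_mul,
      show (n : ℝ) * -ε = -(ε * n) by ring]
    refine (measure_iUnion_le _).trans ?_
    refine (ENNReal.tsum_le_tsum (g := fun g =>
      ENNReal.ofReal (Real.exp (-(ε * n))) * nStep P n 1 g) fun g => ?_).trans_eq ?_
    · by_cases h : pathMeasure P (A ∩ {z | z n = g}) <
        ENNReal.ofReal (Real.exp (-(ε * n))) * nStep P n 1 g
      · refine (measure_mono fun x hx => ?_).trans h.le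
        exact ⟨hx.1.1, hx.2⟩
      · have : s n ∩ {x | x n = g} = ∅ := by
          refine Set.eq_empty_of_forall_notMem fun x hx => h ?_
          have h1 := hx.1.2
          rwa [show x n = g from hx.2] at h1
        rw [this, measure_empty]
        exact zero_le
    · rw [ENNReal.tsum_mul_left, PMF.tsum_coe, mul_one]
  have hsum : ∑' n, pathMeasure P (s n) ≠ ∞ := by
    refine ne_top_of_le_ne_top ?_ (ENNReal.tsum_le_tsum hs)
    rw [ENNReal.tsum_geometric]
    refine ENNReal.inv_ne_top.2 (tsub_pos_of_lt ?_).ne'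
    rw [ENNReal.ofReal_lt_one, Real.exp_lt_one_iff]
    linarith
  filter_upwards [ae_eventually_notMem hsum] with x hx hxA
  filter_upwards [hx] with n hn
  exact not_lt.1 fun h => hn ⟨hxA, h⟩

end WalkDistribution

/-! ### Shadows of vertices -/

section Shadows

variable {Γ : Type*} [Group Γ] {S : Set Γ}

/-- The chain `γ i`, `x m`, `x n = z n`, `z m`, `γ' j` has all products at least `K`; bisection
loses `2 * δ`. -/
theorem Tracks.le_bdryProd {δ : ℝ} (hc : (SimpleGraph.mulCayley S).Connected)
    (hδ : IsHypConst S δ) {l : ℝ} (hl : 0 < l) {x z : ℕ → Γ} {ξ ζ : Boundary S}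
    (hx : Tracks S l x ξ) (hz : Tracks S l z ζ) {n : ℕ} (hxz : x n = z n) {K : ℝ}
    (hKx : ∀ m, n ≤ m → K ≤ gromovProd S (x n) (x m) 1)
    (hKz : ∀ m, n ≤ m → K ≤ gromovProd S (z n) (z m) 1) :
    ((K - 2 * δ : ℝ) : EReal) ≤ bdryProd ξ ζ := by
  obtain ⟨γ, rfl, hγ⟩ := hx
  obtain ⟨γ', rfl, hγ'⟩ := hz
  obtain ⟨m, h1, h2, hm⟩ := ((Tracks.eventually_le_gromovProd hc hδ hl hγ K).and
    ((Tracks.eventually_le_gromovProd hc hδ hl hγ' K).and (eventually_ge_atTop n))).exists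
  obtain ⟨N, hN⟩ := eventually_atTop.1 (h1.and h2)
  refine HypWalk.le_bdryProd (N := N) fun i hi j hj => ?_
  have h3 := hδ.trans (hN i hi).1 ((gromovProd_comm (S := S) (x m) (x n) 1).symm ▸ hKx m hm)
  have h4 := hδ.trans (hN j hj).2 ((gromovProd_comm (S := S) (z m) (z n) 1).symm ▸ hKz m hm)
  rw [gromovProd_comm, ← hxz] at h4
  have := hδ.trans h3 h4
  linarith

/-- The paths that converge with linear rate `a` from time `M` on. -/
def fastPaths (S : Set Γ) (a : ℝ) (M : ℕ) : Set (ℕ → Γ) :=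
  {x | ∀ n, M ≤ n → ∀ m, n ≤ m → a * n ≤ gromovProd S (x n) (x m) 1}

/-- A neighbourhood of the limits of the paths in `fastPaths S a M` that visit `g` at time `n`. -/
def shadow (S : Set Γ) (l a : ℝ) (M n : ℕ) (g : Γ) : Set (Boundary S) :=
  interior {η | ∃ ξ, (∃ z ∈ fastPaths S a M, Tracks S l z ξ ∧ z n = g) ∧
    ((a * n : ℝ) : EReal) < bdryProd ξ η}

theorem Tracks.mem_shadow {δ : ℝ} (hc : (SimpleGraph.mulCayley S).Connected)
    (hδ : IsHypConst S δ) {l a : ℝ} {M : ℕ} {z : ℕ → Γ} {ξ : Boundary S}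
    (hz : Tracks S l z ξ) (hzM : z ∈ fastPaths S a M) (n : ℕ) : ξ ∈ shadow S l a M n (z n) :=
  mem_interior_of_forall_lt hc hδ fun _ hη => ⟨ξ, ⟨z, hzM, hz, rfl⟩, hη⟩

/-- Both points are close to limits of fast paths through `g`. The comparison of these limits and
the two joins cost `2 * δ` each; the `3` provides strict inequalities. -/
theorem lt_bdryProd_of_mem_shadow {δ : ℝ} (hc : (SimpleGraph.mulCayley S).Connected)
    (hδ : IsHypConst S δ) {l a : ℝ} (hl : 0 < l) {M n : ℕ} (hMn : M ≤ n) {g : Γ}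
    {ξ η : Boundary S} (hξ : ξ ∈ shadow S l a M n g) (hη : η ∈ shadow S l a M n g) :
    ((a * n - (6 * δ + 3) : ℝ) : EReal) < bdryProd ξ η := by
  obtain ⟨ξ', ⟨z, hz, hzξ, hzg⟩, h1⟩ := interior_subset hξ
  obtain ⟨η', ⟨y, hy, hyη, hyg⟩, h2⟩ := interior_subset hη
  have hδ0 := hδ.1
  have h3 := hzξ.le_bdryProd hc hδ hl hyη (hzg.trans hyg.symm) (hz n hMn) (hy n hMn)
  rw [bdryProd_comm] at h1
  have mono : ∀ {s t : ℝ} {e : EReal}, (t : EReal) ≤ e → s < t → (s : EReal) < e :=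
    fun h hst => (EReal.coe_lt_coe_iff.2 hst).trans_le h
  have h4 := bdryProd_trans hc hδ (a := a * n - 2 * δ - 1) (mono h1.le (by linarith))
    (mono h3 (by linarith))
  have h5 := bdryProd_trans hc hδ (a := a * n - 4 * δ - 2) (mono h4 (by linarith))
    (mono h2.le (by linarith))
  exact mono h5 (by linarith)

end Shadows

/-! ### Covers by heavy shadows -/

section Covers

variable {Γ : Type*} [Group Γ] [MeasurableSpace Γ] [DiscreteMeasurableSpace Γ] {S : Set Γ}

/-- Almost every limit point lies, for all large `n`, in one of the sets of a cover consisting of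
at most `exp (b * n)` sets of measure at least `exp (-b * n)` and of diameter of the order of
`exp (-a * n)`. -/
theorem exists_covers (hfin : S.Finite) (hc : (SimpleGraph.mulCayley S).Connected)
    {δ : ℝ} (hδ : IsHypConst S δ) {P : Γ → PMF Γ} (hP : IsNearestNeighbor S P) {h l : ℝ}
    (hreg : IsRegularChain S P h l) (hl : 0 < l) {bnd : (ℕ → Γ) → Boundary S}
    (hbnd : AEMeasurable bnd (pathMeasure P)) (htr : ∀ᵐ x ∂pathMeasure P, Tracks S l x (bnd x))
    {a b : ℝ} (ha : a < l) (hb : h < b) :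
    ∃ (c : ℝ) (E : ℕ × ℕ → Set (Boundary S)), (∀ j, MeasurableSet (E j)) ∧
      (∀ᵐ x ∂pathMeasure P, ∃ j, bnd x ∈ E j) ∧
      ∀ j, ∀ᶠ n : ℕ in atTop, ∃ (V : Γ → Set (Boundary S)) (w : Γ → ℝ≥0∞),
        E j ⊆ ⋃ g, V g ∧ ∑' g, w g ≤ 1 ∧
        (∀ g, (V g).Nonempty → ENNReal.ofReal (Real.exp (-(b * n))) ≤ w g) ∧
        (∀ g, (V g).Nonempty → w g ≤ (pathMeasure P).map bnd (V g)) ∧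
        ∀ g, ∀ ξ ∈ V g, ∀ η ∈ V g, ((a * n - c : ℝ) : EReal) < bdryProd ξ η := by
  classical
  have hcount := countable_of_connected hfin hc
  obtain ⟨b', hb1, hb2⟩ := exists_between hb
  -- Shadows may overlap, but these weights belong to disjoint events, so their sum is at most one.
  -- Shadows of light vertices are discarded in `V`.
  let w : ℕ → ℕ → Γ → ℝ≥0∞ := fun M n g =>
    pathMeasure P (fastPaths S a M ∩ {z | z n = g})
  let V : ℕ → ℕ → Γ → Set (Boundary S) := fun M n g =>
    if ENNReal.ofReal (Real.exp (-(b * n))) ≤ w M n g then shadow S l a M n g else ∅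
  -- The interior in `shadow` makes these sets Borel without any measurability of the set of limit
  -- points.
  have hVm : ∀ M n g, MeasurableSet (V M n g) := by
    intro M n g
    simp only [V]
    split_ifs
    · exact isOpen_interior.measurableSet
    · exact MeasurableSet.empty
  have hV : ∀ M n g, (V M n g).Nonempty → ENNReal.ofReal (Real.exp (-(b * n))) ≤ w M n g ∧
      V M n g = shadow S l a M n g := by
    intro M n g hne
    by_cases hw : ENNReal.ofReal (Real.exp (-(b * n))) ≤ w M n g
    · exact ⟨hw, if_pos hw⟩
    · simp [V, if_neg hw] at hne
  -- The index `j = (M, N)` records the time `M` from which convergence is fast and the time `N`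
  -- from which heavy shadows contain the limit.
  refine ⟨6 * δ + 3, fun j => ⋂ n, ⋂ _ : j.2 ≤ n, ⋃ g, V j.1 n g, fun j =>
    MeasurableSet.iInter fun n => MeasurableSet.iInter fun _ =>
      MeasurableSet.iUnion fun g => hVm _ _ _, ?_, fun j => ?_⟩
  · have hBC := ae_all_iff.2 fun M =>
      ae_eventually_mul_nStep_le P (fastPaths S a M) (sub_pos.2 hb2)
    filter_upwards [htr, hBC, ae_adj hP, hreg.speed, hreg.entropy, ae_nStep_ne_zero P]
      with x htr hBC hadj hspeed hent hne
    have hlin : IsLinearPath S l x := ⟨hadj, hspeed⟩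
    obtain ⟨M, hM⟩ := eventually_atTop.1 (hlin.eventually_le_gromovProd hc hδ hl ha)
    obtain ⟨N, hN⟩ := eventually_atTop.1 ((hBC M hM).and
      ((hent.eventually_lt_const hb1).and (eventually_gt_atTop 0)))
    refine ⟨(M, N), Set.mem_iInter₂.2 fun n hn => Set.mem_iUnion.2 ⟨x n, ?_⟩⟩
    obtain ⟨h1, h2, h0⟩ := hN n hn
    have hw : ENNReal.ofReal (Real.exp (-(b * n))) ≤ w M n (x n) := by
      refine le_trans ?_ h1
      have h3 : ENNReal.ofReal (Real.exp (-(b' * n))) ≤ nStep P n 1 (x n) := by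
        have htop := (nStep P n 1).apply_ne_top (x n)
        have hpos : 0 < (nStep P n 1 (x n)).toReal := ENNReal.toReal_pos (hne n) htop
        rw [ENNReal.ofReal_le_iff_le_toReal htop, ← Real.le_log_iff_exp_le hpos]
        rw [div_lt_iff₀ (by exact_mod_cast h0)] at h2
        linarith
      calc ENNReal.ofReal (Real.exp (-(b * n)))
          = ENNReal.ofReal (Real.exp (-((b - b') * n))) *
              ENNReal.ofReal (Real.exp (-(b' * n))) := by
            rw [← ENNReal.ofReal_mul (Real.exp_pos _).le, ← Real.exp_add]
            congr 2
            ring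
        _ ≤ _ := by gcongr
    simp only [V, if_pos hw]
    exact htr.mem_shadow hc hδ hM n
  · filter_upwards [eventually_ge_atTop j.1, eventually_ge_atTop j.2] with n hn1 hn2
    refine ⟨V j.1 n, w j.1 n, Set.iInter₂_subset n hn2, ?_, fun g hg => (hV _ _ _ hg).1, ?_, ?_⟩
    · refine (ENNReal.tsum_le_tsum fun g => ?_).trans_eq (nStep P n 1).tsum_coe
      rw [← pathMeasure_eq_nStep]
      exact measure_mono Set.inter_subset_right
    · intro g hg
      refine le_trans (measure_mono_ae ?_) (Measure.le_map_apply hbnd _)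
      filter_upwards [htr] with x hx hx'
      change bnd x ∈ V j.1 n g
      rw [(hV _ _ _ hg).2, ← show x n = g from hx'.2]
      exact hx.mem_shadow hc hδ hx'.1 n
    · intro g ξ hξ η hη
      have := (hV _ _ _ ⟨ξ, hξ⟩).2
      rw [this] at hξ hη
      exact lt_bdryProd_of_mem_shadow hc hδ hl hn1 hξ hη

end Covers

/-! ### From shadow masses to local dimension -/

section LocalDimension

variable {Γ : Type*} [Group Γ] {S : Set Γ}

theorem limsup_log_measure_div_log_le (ν : Measure (Boundary S)) (ξ : Boundary S)
    {a b c q : ℝ} (ha : 0 < a) (hb : 0 ≤ b) (hq : b / a < q)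
    (hξ : ∀ᶠ n : ℕ in atTop, ENNReal.ofReal (Real.exp (-(b * n))) ≤
      ν (bdryBall ξ (Real.exp (-(a * n - c))))) :
    limsup (fun r : ℝ => ENNReal.log (ν (bdryBall ξ r)) / ((Real.log r : ℝ) : EReal))
      (𝓝[>] 0) ≤ (q : EReal) := by
  obtain ⟨N, hN⟩ := eventually_atTop.1 hξ
  refine limsup_le_of_le (by isBoundedDefault) ?_
  have hlog : Tendsto (fun r => -Real.log r) (𝓝[>] 0) atTop :=
    tendsto_neg_atBot_atTop.comp Real.tendsto_log_nhdsGT_zero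
  filter_upwards [self_mem_nhdsWithin, hlog.eventually_gt_atTop 0,
    hlog.eventually_ge_atTop (-c), hlog.eventually_ge_atTop (a * N - c),
    (hlog.const_mul_atTop (sub_pos.2 hq)).eventually_ge_atTop (b * (c / a + 1))]
    with r hr h1 h2 h3 h4
  set L := -Real.log r with hL
  -- The first `n` with `exp (-(a * n - c)) ≤ r`; the strict inequality `b / a < q` absorbs the
  -- rounding as `r → 0`.
  set n := ⌈(c + L) / a⌉₊
  have hn1 : (c + L) / a ≤ n := Nat.le_ceil _
  have hn2 : (n : ℝ) < (c + L) / a + 1 := Nat.ceil_lt_add_one (div_nonneg (by linarith) ha.le)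
  have hNn : N ≤ n := by
    have : (N : ℝ) ≤ n := le_trans (by rw [le_div_iff₀ ha]; linarith) hn1
    exact_mod_cast this
  have hball : ν (bdryBall ξ (Real.exp (-(a * n - c)))) ≤ ν (bdryBall ξ r) := by
    refine measure_mono (bdryBall_mono ξ ?_)
    rw [div_le_iff₀ ha] at hn1
    rw [← Real.exp_log hr]
    exact Real.exp_le_exp.2 (by linarith)
  have hbn : b * n ≤ q * L := by
    calc b * n ≤ b * ((c + L) / a + 1) := by gcongr
      _ = b * (c / a + 1) + b / a * L := by ring
      _ ≤ q * L := by linarith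
  have hν : ((q * Real.log r : ℝ) : EReal) ≤ ENNReal.log (ν (bdryBall ξ r)) := by
    have h5 : ENNReal.ofReal (Real.exp (q * Real.log r)) ≤ ν (bdryBall ξ r) := by
      refine le_trans (ENNReal.ofReal_le_ofReal (Real.exp_le_exp.2 ?_)) ((hN n hNn).trans hball)
      have : q * L = -(q * Real.log r) := by rw [hL]; ring
      linarith
    have h6 := ENNReal.log_monotone h5
    rwa [ENNReal.log_ofReal, if_neg (not_le.2 (Real.exp_pos _)), Real.log_exp] at h6
  have hlt : Real.log r < 0 := by linarith
  refine (EReal.antitone_div_right_of_nonpos (b := ((Real.log r : ℝ) : EReal))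
    (by exact_mod_cast hlt.le) hν).trans_eq ?_
  change ((q * Real.log r : ℝ) : EReal) / ((Real.log r : ℝ) : EReal) = q
  rw [← EReal.coe_div, mul_div_cancel_right₀ _ hlt.ne]

theorem qdiam_le_of_forall {V : Set (Boundary S)} {s : ℝ}
    (h : ∀ ξ ∈ V, ∀ η ∈ V, (s : EReal) < bdryProd ξ η) :
    qdiam rho V ≤ ENNReal.ofReal (Real.exp (-s)) := by
  refine iSup₂_le fun ξ hξ => iSup₂_le fun η hη => ?_
  rw [rho, ← EReal.exp_coe, EReal.exp_le_exp_iff, EReal.coe_neg, EReal.neg_le_neg_iff]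
  exact (h ξ hξ η hη).le

end LocalDimension

/-! ### Hausdorff dimension from weighted covers -/

section HausdorffDimension

/-- Double families are enumerated by `ℕ` with empty sets as padding, which contribute nothing even
when `d = 0`. -/
theorem qHausdorff_le_of_covers {X ι κ : Type*} [Countable ι] [Countable κ]
    (ρ : X → X → ℝ≥0∞) (d : ℝ≥0) (C : ℝ≥0∞) (E : Set X)
    (h : ∀ r, 0 < r → ∃ W : ι → κ → Set X, E ⊆ ⋃ i, ⋃ j, W i j ∧
      (∀ i j, qdiam ρ (W i j) ≤ r) ∧
      ∑' i, ∑' j, ⨆ _ : (W i j).Nonempty, qdiam ρ (W i j) ^ (d : ℝ) ≤ C) :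
    qHausdorff ρ d E ≤ C := by
  refine iSup₂_le fun r hr => ?_
  obtain ⟨W, hE, hdiam, hsum⟩ := h r hr
  have := Encodable.ofCountable ι
  have := Encodable.ofCountable κ
  let s : ι × κ → Set X := fun q => W q.1 q.2
  refine (iInf₂_le_of_le (fun n => ⋃ q ∈ Encodable.decode₂ (ι × κ) n, s q) ?_
    (iInf_le_of_le (fun n => ?_) le_rfl)).trans ?_
  · rw [Encodable.iUnion_decode₂]
    refine hE.trans (Set.iUnion₂_subset fun i j => ?_)
    exact Set.subset_iUnion s (i, j)
  · refine Encodable.iUnion_decode₂_cases (C := fun A => qdiam ρ A ≤ r) ?_ fun q => hdiam _ _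
    simp [qdiam]
  · rw [tsum_iUnion_decode₂ (fun A : Set X => ⨆ _ : A.Nonempty, qdiam ρ A ^ (d : ℝ)) (by simp) s,
      ENNReal.tsum_prod']
    exact hsum

theorem tendsto_ofReal_exp_linear {s : ℝ} (hs : s < 0) (t : ℝ) :
    Tendsto (fun n : ℕ => ENNReal.ofReal (Real.exp (s * n + t))) atTop (𝓝 0) := by
  rw [← ENNReal.ofReal_zero]
  refine ENNReal.tendsto_ofReal (Real.tendsto_exp_atBot.comp ?_)
  exact tendsto_atBot_add_const_right _ _
    (tendsto_natCast_atTop_atTop.const_mul_atTop_of_neg hs)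

variable {Γ : Type*} [Group Γ] [Countable Γ] {S : Set Γ}

/-- A nonempty `V g` satisfies `1 ≤ w g * exp (b * n)`, so the sum of the `d`-th powers of diameters
is at most `exp ((b - a * d) * n + c * d)`, which tends to zero. Each `E j` chooses its own `n` to
meet its share `ε j` of the budget. -/
theorem qHausdorff_le_one_of_covers {ι : Type*} [Countable ι] {G : Set (Boundary S)}
    {E : ι → Set (Boundary S)} (hG : G ⊆ ⋃ j, E j) {a b c : ℝ} {d : ℝ≥0} (ha : 0 < a)
    (hd : b < a * d)
    (hE : ∀ j, ∀ᶠ n : ℕ in atTop, ∃ (V : Γ → Set (Boundary S)) (w : Γ → ℝ≥0∞),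
      E j ⊆ ⋃ g, V g ∧ ∑' g, w g ≤ 1 ∧
      (∀ g, (V g).Nonempty → ENNReal.ofReal (Real.exp (-(b * n))) ≤ w g) ∧
      ∀ g, ∀ ξ ∈ V g, ∀ η ∈ V g, ((a * n - c : ℝ) : EReal) < bdryProd ξ η) :
    qHausdorff rho d G ≤ 1 := by
  refine qHausdorff_le_of_covers (ι := ι) (κ := Γ) _ _ _ _ fun r hr => ?_
  obtain ⟨ε, hε, hεsum⟩ := ENNReal.exists_pos_sum_of_countable' one_ne_zero ι
  have hex : ∀ j, ∃ V : Γ → Set (Boundary S), E j ⊆ ⋃ g, V g ∧ (∀ g, qdiam rho (V g) ≤ r) ∧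
      ∑' g, ⨆ _ : (V g).Nonempty, qdiam rho (V g) ^ (d : ℝ) ≤ ε j := by
    intro j
    obtain ⟨n, ⟨V, w, hV, hw, hVw, hdiam⟩, hn1, hn2⟩ := ((hE j).and
      (((tendsto_ofReal_exp_linear (neg_neg_of_pos ha) c).eventually_le_const hr).and
      ((tendsto_ofReal_exp_linear (sub_neg.2 hd) (c * d)).eventually_le_const (hε j)))).exists
    have hD : ∀ g, qdiam rho (V g) ≤ ENNReal.ofReal (Real.exp (-a * n + c)) := fun g =>
      (qdiam_le_of_forall (hdiam g)).trans_eq (by congr 2; ring)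
    refine ⟨V, hV, fun g => (hD g).trans hn1, ?_⟩
    set K := ENNReal.ofReal (Real.exp ((b - a * d) * n + c * d))
    have hK : K = ENNReal.ofReal (Real.exp (b * n)) *
        ENNReal.ofReal (Real.exp (-a * n + c)) ^ (d : ℝ) := by
      rw [ENNReal.ofReal_rpow_of_pos (Real.exp_pos _), ← Real.exp_mul,
        ← ENNReal.ofReal_mul (Real.exp_pos _).le, ← Real.exp_add]
      exact congrArg (fun t => ENNReal.ofReal (Real.exp t)) (by ring)
    calc ∑' g, ⨆ _ : (V g).Nonempty, qdiam rho (V g) ^ (d : ℝ) ≤ ∑' g, w g * K := by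
          refine ENNReal.tsum_le_tsum fun g => iSup_le fun hne => ?_
          have h1 : 1 ≤ w g * ENNReal.ofReal (Real.exp (b * n)) := by
            refine le_trans ?_ (mul_le_mul_left (hVw g hne) _)
            rw [← ENNReal.ofReal_mul (Real.exp_pos _).le, ← Real.exp_add]
            simp
          rw [hK, ← mul_assoc]
          refine le_trans ?_ (mul_le_mul_left h1 _)
          rw [one_mul]
          exact ENNReal.rpow_le_rpow (hD g) d.2
      _ = (∑' g, w g) * K := ENNReal.tsum_mul_right
      _ ≤ 1 * K := by gcongr
      _ ≤ ε j := by rw [one_mul]; exact hn2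
  choose W hW hdiam hsum using hex
  exact ⟨W, hG.trans (Set.iUnion_mono hW), hdiam,
    (ENNReal.tsum_le_tsum hsum).trans hεsum.le⟩

end HausdorffDimension

end HypWalk

/-! ### Harmonic measure and the two dimension bounds -/

open HypWalk
theorem mainTheorem5 {Γ : Type*} [Group Γ] [MeasurableSpace Γ] [DiscreteMeasurableSpace Γ]
    (S : Set Γ) (hfin : S.Finite) (hsymm : ∀ s ∈ S, s⁻¹ ∈ S) (hone : (1 : Γ) ∉ S)
    (hgen : Subgroup.closure S = ⊤) (hhyp : IsHyperbolic S)
    (P : Γ → PMF Γ) (hP : IsNearestNeighbor S P)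
    (h l : ℝ) (hreg : IsRegularChain S P h l) (hl : 0 < l) :
    (∃! ν : Measure (Boundary S), IsHarmonicMeasure S P l ν) ∧
    ∀ ν : Measure (Boundary S), IsHarmonicMeasure S P l ν →
      (∀ᵐ ξ ∂ν,
        limsup (fun r : ℝ => ENNReal.log (ν (bdryBall ξ r)) / ((Real.log r : ℝ) : EReal))
          (𝓝[>] 0) ≤ ((h / l : ℝ) : EReal)) ∧
      measureDim rho ν ≤ ENNReal.ofReal (h / l) := by
  have hc := mulCayley_connected hgen
  have hcount := countable_of_connected hfin hc
  obtain ⟨δ, hδ⟩ := hhyp.exists_isHypConst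
  refine ⟨?_, ?_⟩
  · have hlin : ∀ᵐ x ∂pathMeasure P, IsLinearPath S l x := by
      filter_upwards [ae_adj hP, hreg.speed] with x h1 h2 using ⟨h1, h2⟩
    -- One linear path yields a ray, hence the default boundary point needed for the boundary map.
    obtain ⟨x, hx⟩ := hlin.exists
    obtain ⟨c, hcs⟩ := exists_isGeodesicSystem hc
    obtain ⟨γ, -⟩ := hx.exists_ray hfin hc hl hcs (p := fun _ => True)
      (Eventually.of_forall fun _ => trivial).frequently
    have : Nonempty (Ray S) := ⟨γ⟩
    obtain ⟨bnd, hm, hbnd⟩ := exists_boundaryMap hfin hc hδ hl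
    refine ⟨(pathMeasure P).map bnd, ⟨bnd, hm.aemeasurable, hlin.mono hbnd, rfl⟩, ?_⟩
    rintro _ ⟨f, -, hf, rfl⟩
    refine Measure.map_congr ?_
    filter_upwards [hf, hlin] with x h1 h2
    exact h1.unique hc hδ hl (hbnd x h2)
  · rintro _ ⟨bnd, hbnd, htr, rfl⟩
    have hprob := Measure.isProbabilityMeasure_map hbnd
    -- Rational rates are countably many, so a single Borel set `G` of full measure serves all of
    -- them.
    let ι := {p : ℚ × ℚ // (p.1 : ℝ) < l ∧ h < p.2}
    have hcov := fun p : ι => exists_covers hfin hc hδ hP hreg hl hbnd htr p.2.1 p.2.2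
    choose c E hEm hEae hE using hcov
    let G : Set (Boundary S) := ⋂ p, ⋃ j, E p j
    have hGm : MeasurableSet G :=
      MeasurableSet.iInter fun p => MeasurableSet.iUnion fun j => hEm p j
    have hGae : ∀ᵐ ξ ∂(pathMeasure P).map bnd, ξ ∈ G := by
      refine (ae_map_iff (p := fun ξ => ξ ∈ G) hbnd hGm).2 ?_
      filter_upwards [ae_all_iff.2 hEae] with x hx
      exact Set.mem_iInter.2 fun p => Set.mem_iUnion.2 (hx p)
    have hpair : ∀ q : ℝ, h / l < q → ∃ p : ι, 0 < (p.1.1 : ℝ) ∧ 0 ≤ (p.1.2 : ℝ) ∧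
        (p.1.2 : ℝ) / p.1.1 < q := by
      intro q hq
      have hh := hreg.entropy_nonneg
      have hq0 : 0 < q := (div_nonneg hh hl.le).trans_lt hq
      -- First `h < b < q * l`, then `b / q < a < l`.
      obtain ⟨b, hb1, hb2⟩ := exists_rat_btwn ((div_lt_iff₀ hl).1 hq)
      have hb0 : (0 : ℝ) < b := hh.trans_lt hb1
      obtain ⟨a, ha1, ha2⟩ := exists_rat_btwn ((div_lt_iff₀' hq0).2 hb2)
      have ha0 : (0 : ℝ) < a := (div_pos hb0 hq0).trans ha1
      refine ⟨⟨(a, b), ha2, hb1⟩, ha0, hb0.le, ?_⟩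
      rw [div_lt_iff₀ ha0]
      exact (div_lt_iff₀' hq0).1 ha1
    refine ⟨?_, ?_⟩
    · filter_upwards [hGae] with ξ hξ
      refine EReal.le_of_forall_lt_iff_le.1 fun q hq => ?_
      obtain ⟨p, ha, hb, hpq⟩ := hpair q (EReal.coe_lt_coe_iff.1 hq)
      obtain ⟨j, hj⟩ := Set.mem_iUnion.1 (Set.mem_iInter.1 hξ p)
      refine limsup_log_measure_div_log_le (c := c p) _ _ ha hb hpq ?_
      filter_upwards [hE p j] with n hn
      obtain ⟨V, w, hV, -, hw, hwν, hdiam⟩ := hn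
      obtain ⟨g, hg⟩ := Set.mem_iUnion.1 (hV hj)
      refine ((hw g ⟨ξ, hg⟩).trans (hwν g ⟨ξ, hg⟩)).trans (measure_mono fun η hη => ?_)
      exact mem_bdryBall_exp_neg.2 (hdiam g ξ hg η hη)
    · refine (iInf₂_le_of_le G hGm
        (iInf_le_of_le (mem_ae_iff_prob_eq_one hGm |>.1 hGae) le_rfl)).trans ?_
      refine iSup₂_le fun d hd => ?_
      -- A dimension `d > h / l` admits rates with `b < a * d`, and then the `d`-dimensional measure
      -- of `G` is at most one, not infinite.
      by_contra hlt
      have hd' : h / l < d := by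
        rw [not_le, ← ENNReal.ofReal_coe_nnreal] at hlt
        exact (ENNReal.ofReal_lt_ofReal_iff_of_nonneg
          (div_nonneg hreg.entropy_nonneg hl.le)).1 hlt
      obtain ⟨p, ha, hb, hpq⟩ := hpair d hd'
      have := qHausdorff_le_one_of_covers (d := d) (Set.iInter_subset _ p : G ⊆ _) ha
        ((div_lt_iff₀' ha).1 hpq) fun j => (hE p j).mono fun n ⟨V, w, h1, h2, h3, _, h5⟩ =>
          ⟨V, w, h1, h2, h3, h5⟩
      rw [hd] at this
      exact absurd this (by simp)
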